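/- Let $X$ be a Euclidean space (a finite-dimensional real inner product space). For a nonempty set $C\subseteq X$ let $d_C(x)=\inf_{c\in C}\|x-c\|$, $P_C(x)=\{c\in C:\|x-c\|=d_C(x)\}$ and, for a real number $\lambda$, $P_C^\lambda=(1-\lambda)\operatorname{Id}+\lambda P_C$. For nonempty closed sets $A,B\subseteq X$, the generalized Douglas–Rachford (gDR) operator with parameters $\lambda,\mu\in\left]0,2\right]$ and $\alpha>0$ is $T_{\lambda,\mu}^\alpha=(1-\alpha)\operatorname{Id}+\alpha P_B^\mu P_A^\lambda$, and $\operatorname{Fix}T=\{x\in X: x\in Tx\}$. For a nonempty set $C\subseteq X$, an operator $T\colon X\rightrightarrows X$ is called $C$-quasi coercive on a set $U\subseteq X$ if there is $\nu>0$ such that $\|x-x_+\|\ge\nu\, d_C(x)$ for all $x\in U$ and all $x_+\in Tx$. A polyhedral set is an intersection of finitely many closed half-spaces; $\operatorname{ri}$ denotes the relative interior and $\operatorname{aff}$ the affine hull. Let $\lambda,\mu\in\left]0,2\right]$ and $\alpha>0$. Then the following hold. (i) If $A$ and $B$ are closed convex subsets of $X$ with $\operatorname{ri}A\cap\operatorname{ri}B\neq\varnothing$,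 and $L:=\operatorname{aff}(A\cup B)$, then $T_{\lambda,\mu}^\alpha$ is $\big((A\cap B)+(L-L)^\perp\big)$-quasi coercive on every bounded set $S\subseteq X$. If additionally $\min\{\lambda,\mu\}<2$, then $T_{\lambda,\mu}^\alpha$ is $(A\cap B)$-quasi coercive on every bounded set $S\subseteq X$. (ii) If $A$ and $B$ are polyhedral subsets of $X$ with $A\cap B\neq\varnothing$, then $T_{\lambda,\mu}^\alpha$ is $\operatorname{Fix}T_{\lambda,\mu}^\alpha$-quasi coercive on every bounded set $S\subseteq X$. -/

import Mathlib

open scoped Pointwise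

/-- The set-valued projector onto `C`: all points of `C` that realize the distance from `x` to `C`. -/
def projector {X : Type*} [NormedAddCommGroup X] (C : Set X) (x : X) : Set X :=
  {c | c ∈ C ∧ ‖x - c‖ = Metric.infDist x C}

/-- The set-valued relaxed projector `(1 - r) Id + r P_C`. -/
def relaxedProjector {X : Type*} [NormedAddCommGroup X] [NormedSpace ℝ X]
    (C : Set X) (r : ℝ) (x : X) : Set X :=
  {y | ∃ p ∈ projector C x, y = (1 - r) • x + r • p}

/-- The set-valued generalized Douglas-Rachford operator
`(1 - α) Id + α P_B^μ P_A^lam`, where `P_A^lam`, `P_B^μ` are relaxed projectors. -/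
def gDR {X : Type*} [NormedAddCommGroup X] [NormedSpace ℝ X]
    (A B : Set X) (lam μ α : ℝ) (x : X) : Set X :=
  {y | ∃ r ∈ relaxedProjector A lam x, ∃ s ∈ relaxedProjector B μ r,
    y = (1 - α) • x + α • s}

/-- The fixed points of a set-valued operator. -/
def fixSet {X : Type*} (T : X → Set X) : Set X :=
  {x | x ∈ T x}

/-- `T` is `(C, ν)`-quasi coercive on `U` (used for nonempty `C`, where `Metric.infDist x C`
is the infimum of `‖x - c‖` over `c ∈ C`). -/
def QuasiCoerciveWith {X : Type*} [NormedAddCommGroup X]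
    (T : X → Set X) (C : Set X) (ν : ℝ) (U : Set X) : Prop :=
  ∀ x ∈ U, ∀ y ∈ T x, ν * Metric.infDist x C ≤ ‖x - y‖

/-- `T` is `C`-quasi coercive on `U`: it is so with some constant `ν > 0`. -/
def QuasiCoerciveOn {X : Type*} [NormedAddCommGroup X]
    (T : X → Set X) (C : Set X) (U : Set X) : Prop :=
  ∃ ν : ℝ, 0 < ν ∧ QuasiCoerciveWith T C ν U

/-- A polyhedral set: the intersection of finitely many closed half-spaces. (Vectors `a i = 0`
are harmless: they only contribute the whole space or the empty set.) -/
def IsPolyhedral {X : Type*} [NormedAddCommGroup X] [InnerProductSpace ℝ X]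
    (P : Set X) : Prop :=
  ∃ (n : ℕ) (a : Fin n → X) (b : Fin n → ℝ), P = {x | ∀ i, inner ℝ (a i) x ≤ b i}

/-! ### Projections and the displacement of the operator. -/

section Projector

variable {X : Type*} [NormedAddCommGroup X] [InnerProductSpace ℝ X]

/-! By `mem_gDR_iff`, x - y = αw with w = λu + μv, where u = x - a and v = (x - λu) - b are the
residuals of the two projections. Both parts ask for points of the target set within O(‖w‖) of x,
uniformly on bounded sets.

For (i), let c be a common relative interior point, V and W the directions of A and B, and κ = λ + μ
- λμ ≥ 0. The variational inequalities bound the pairings of u, v with small vectors of V, W by ⟨u,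
a - c⟩, ⟨v, b - c⟩ ≥ 0, and `inner_residuals_le` makes these O(‖w‖). As λu = w - μv, u also pairs to
O(‖w‖) with W, so its projection Qu on V + W is O(‖w‖). Projecting μ(a - b) = -κu + w gives a - b =
O(‖w‖), and linear regularity yields z ∈ A ∩ B near a. The leftover n = u - Qu is orthogonal to V +
W and κn = w - Qw, so n is small too when κ > 0.

For (ii), normal cone graphs of polyhedral sets are finite unions of polyhedra
(`IsPolyhedral.exists_normal_pieces`). The triples (a, b, u) then fill finitely many polyhedra on
which w is linear and vanishes only at data of fixed points. Hoffman's bound settles the pieces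
where w has a zero, compactness the others. -/

/-- Over a convex set, projections are characterized by the variational inequality. -/
theorem mem_projector_iff {C : Set X} (hC : Convex ℝ C) {x p : X} :
    p ∈ projector C x ↔ p ∈ C ∧ ∀ z ∈ C, inner ℝ (x - p) (z - p) ≤ 0 := by
  refine and_congr_right fun hp => ?_
  rw [← norm_eq_iInf_iff_real_inner_le_zero hC hp, Metric.infDist_eq_iInf]
  simp only [dist_eq_norm]

theorem norm_sub_le_of_mem_projector {X : Type*} [NormedAddCommGroup X] {C : Set X} {x p z : X} (hp : p ∈ projector C x)
    (hz : z ∈ C) : ‖x - p‖ ≤ ‖x - z‖ := by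
  rw [hp.2, ← dist_eq_norm]
  exact Metric.infDist_le_dist_of_mem hz

theorem self_mem_projector {X : Type*} [NormedAddCommGroup X] {C : Set X} {x : X} (hx : x ∈ C) : x ∈ projector C x :=
  ⟨hx, by simp [Metric.infDist_zero_of_mem hx]⟩

/-- The displacement of the gDR operator in terms of the residuals of the two projections. -/
theorem mem_gDR_iff {A B : Set X} {lam μ α : ℝ} {x y : X} :
    y ∈ gDR A B lam μ α x ↔ ∃ a ∈ projector A x, ∃ b ∈ projector B (x - lam • (x - a)),
      x - y = α • (lam • (x - a) + μ • (x - lam • (x - a) - b)) := by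
  have key : ∀ a b : X, y = (1 - α) • x + α • ((1 - μ) • (x - lam • (x - a)) + μ • b) ↔
      x - y = α • (lam • (x - a) + μ • (x - lam • (x - a) - b)) := by
    intro a b
    constructor
    · rintro rfl
      module
    · intro h
      rw [← sub_sub_self x y, h]
      module
  have hr : ∀ a : X, (1 - lam) • x + lam • a = x - lam • (x - a) := fun a => by module
  constructor
  · rintro ⟨_, ⟨a, ha, rfl⟩, _, ⟨b, hb, rfl⟩, h⟩
    rw [hr] at hb h
    exact ⟨a, ha, b, hb, (key a b).1 h⟩
  · rintro ⟨a, ha, b, hb, h⟩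
    exact ⟨_, ⟨a, ha, (hr a).symm⟩, _, ⟨b, hb, rfl⟩, (key a b).2 h⟩

end Projector

/-! ### Quantitative consequences of a common relative interior point. -/

section RelativeInterior

variable {X : Type*} [NormedAddCommGroup X] [InnerProductSpace ℝ X]

theorem exists_ball_of_mem_intrinsicInterior {A : Set X} {c : X}
    (hc : c ∈ intrinsicInterior ℝ A) :
    ∃ δ > 0, ∀ p ∈ (affineSpan ℝ A).direction, ‖p‖ ≤ δ → c + p ∈ A := by
  obtain ⟨y, hy, rfl⟩ := mem_intrinsicInterior.1 hc
  obtain ⟨ε, hε, hball⟩ := Metric.mem_nhds_iff.1 (mem_interior_iff_mem_nhds.1 hy)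
  refine ⟨ε / 2, by positivity, fun p hp hpn => ?_⟩
  have hmem : (y : X) + p ∈ affineSpan ℝ A := by
    rw [add_comm]
    exact AffineSubspace.vadd_mem_of_mem_direction hp y.2
  have : (⟨(y : X) + p, hmem⟩ : affineSpan ℝ A) ∈ Metric.ball y ε := by
    rw [Metric.mem_ball, Subtype.dist_eq, dist_eq_norm]
    simp only [add_sub_cancel_left]
    linarith
  exact hball this

/-- Bounded decompositions along a sum of two subspaces. -/
theorem exists_decomposition_bound [FiniteDimensional ℝ X] (V W : Submodule ℝ X) :
    ∃ K > 0, ∀ w ∈ V ⊔ W, ∃ p ∈ V, ∃ q ∈ W, p + q = w ∧ ‖p‖ ≤ K * ‖w‖ ∧ ‖q‖ ≤ K * ‖w‖ := by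
  let f : (V × W) →ₗ[ℝ] X := V.subtype.coprod W.subtype
  have hf : LinearMap.range f = V ⊔ W := by
    simp [f, LinearMap.range_coprod]
  -- A linear section of (p, q) ↦ p + q is bounded, by finite dimension.
  obtain ⟨g, hg⟩ := f.rangeRestrict.exists_rightInverse_of_surjective
    (LinearMap.range_eq_top.2 f.surjective_rangeRestrict)
  obtain ⟨K, hK, hb⟩ := (LinearMap.toContinuousLinearMap g).bound
  refine ⟨K, hK, fun w hw => ?_⟩
  rw [← hf] at hw
  have hbw := hb ⟨w, hw⟩
  have hgw : f.rangeRestrict (g ⟨w, hw⟩) = ⟨w, hw⟩ := LinearMap.congr_fun hg ⟨w, hw⟩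
  have hgw' : ((g ⟨w, hw⟩).1 : X) + (g ⟨w, hw⟩).2 = w := congrArg Subtype.val hgw
  exact ⟨_, (g ⟨w, hw⟩).1.2, _, (g ⟨w, hw⟩).2.2, hgw',
    (norm_fst_le (g ⟨w, hw⟩)).trans hbw, (norm_snd_le (g ⟨w, hw⟩)).trans hbw⟩

/-- Linear regularity on bounded sets of two convex sets sharing a relative interior point `c`. -/
theorem exists_mem_inter_norm_sub_le [FiniteDimensional ℝ X] {A B : Set X} (hA : Convex ℝ A)
    (hB : Convex ℝ B) {V W : Submodule ℝ X} {c : X} {δ : ℝ} (hδ : 0 < δ)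
    (hcA : ∀ p ∈ V, ‖p‖ ≤ δ → c + p ∈ A) (hcB : ∀ q ∈ W, ‖q‖ ≤ δ → c + q ∈ B) (R : ℝ)
    (hR : 0 ≤ R) :
    ∃ K > 0, ∀ a ∈ A, ∀ b ∈ B, a - b ∈ V ⊔ W → ‖a - c‖ ≤ R →
      ∃ z ∈ A ∩ B, ‖a - z‖ ≤ K * ‖a - b‖ := by
  obtain ⟨K, hK, hdec⟩ := exists_decomposition_bound V W
  refine ⟨K / δ * R + K, by positivity, fun a ha b hb hab haR => ?_⟩
  rcases eq_or_ne a b with rfl | hne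
  · exact ⟨a, ⟨ha, hb⟩, by simp⟩
  have hd : 0 < ‖a - b‖ := norm_pos_iff.2 (sub_ne_zero.2 hne)
  obtain ⟨p, hp, q, hq, hpq, hpn, hqn⟩ := hdec _ hab
  -- With this t, c - p/t ∈ A and c + q/t ∈ B. Since a - p = b + q, averaging them with a and b,
  -- with weights t/(1+t) and 1/(1+t), gives the same point.
  set t : ℝ := K * ‖a - b‖ / δ with ht
  have htpos : 0 < t := by positivity
  have htδ : t * δ = K * ‖a - b‖ := by rw [ht]; field_simp
  have hsmall : ∀ v : X, ‖v‖ ≤ K * ‖a - b‖ → ‖t⁻¹ • v‖ ≤ δ := by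
    intro v hv
    rw [norm_smul, norm_inv, Real.norm_of_nonneg htpos.le, inv_mul_le_iff₀ htpos, htδ]
    exact hv
  have hA' : c + t⁻¹ • (-p) ∈ A := hcA _ (V.smul_mem _ (V.neg_mem hp))
    (hsmall _ (by rwa [norm_neg]))
  have hB' : c + t⁻¹ • q ∈ B := hcB _ (W.smul_mem _ hq) (hsmall _ hqn)
  have h1 : (1 + t)⁻¹ + (1 + t)⁻¹ * t = 1 := by field_simp
  have htt : (1 + t)⁻¹ * t * t⁻¹ = (1 + t)⁻¹ := by field_simp
  have hzA := hA ha hA' (by positivity) (by positivity) h1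
  have hzB := hB hb hB' (by positivity) (by positivity) h1
  have heq : (1 + t)⁻¹ • a + ((1 + t)⁻¹ * t) • (c + t⁻¹ • (-p)) =
      (1 + t)⁻¹ • b + ((1 + t)⁻¹ * t) • (c + t⁻¹ • q) := by
    rw [smul_add, smul_add, smul_smul, smul_smul, htt]
    have : a = b + (p + q) := by rw [hpq]; abel
    rw [this]
    module
  refine ⟨_, ⟨hzA, heq ▸ hzB⟩, ?_⟩
  have hdiff : a - ((1 + t)⁻¹ • a + ((1 + t)⁻¹ * t) • (c + t⁻¹ • (-p))) =
      (1 + t)⁻¹ • (t • (a - c) + p) := by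
    rw [smul_add ((1 + t)⁻¹ * t), smul_smul, htt]
    have ha1 : a = ((1 + t)⁻¹ + (1 + t)⁻¹ * t) • a := by rw [h1, one_smul]
    nth_rewrite 1 [ha1]
    module
  rw [hdiff, norm_smul, norm_inv, Real.norm_of_nonneg (by positivity : (0 : ℝ) ≤ 1 + t)]
  calc (1 + t)⁻¹ * ‖t • (a - c) + p‖ ≤ 1 * ‖t • (a - c) + p‖ := by
        gcongr
        exact inv_le_one_of_one_le₀ (by linarith)
    _ ≤ ‖t • (a - c)‖ + ‖p‖ := by rw [one_mul]; exact norm_add_le _ _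
    _ ≤ t * R + K * ‖a - b‖ := by
        rw [norm_smul, Real.norm_of_nonneg htpos.le]
        gcongr
    _ = (K / δ * R + K) * ‖a - b‖ := by rw [ht]; ring

/-- A vector of a sum of subspaces is controlled by its pairings with small vectors of the
summands. -/
theorem exists_norm_le_of_inner_le [FiniteDimensional ℝ X] (V W : Submodule ℝ X) {δ : ℝ}
    (hδ : 0 < δ) : ∃ K > 0, ∀ w ∈ V ⊔ W, ∀ ε ≥ 0, (∀ p ∈ V, ‖p‖ ≤ δ → inner ℝ w p ≤ ε) →
      (∀ q ∈ W, ‖q‖ ≤ δ → inner ℝ w q ≤ ε) → ‖w‖ ≤ K * ε := by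
  obtain ⟨K, hK, hdec⟩ := exists_decomposition_bound V W
  refine ⟨2 * K / δ, by positivity, fun w hw ε hε hV hW => ?_⟩
  rcases eq_or_ne w 0 with rfl | hne
  · rw [norm_zero]; positivity
  have hpos : 0 < ‖w‖ := norm_pos_iff.2 hne
  obtain ⟨p, hp, q, hq, hpq, hpn, hqn⟩ := hdec w hw
  -- The largest scaling guaranteed to keep sp and sq in the δ-ball; the pairings of w with them add
  -- up to s‖w‖².
  set s : ℝ := δ / (K * ‖w‖) with hs
  have hspos : 0 < s := by positivity
  have hsmall : ∀ v : X, ‖v‖ ≤ K * ‖w‖ → ‖s • v‖ ≤ δ := by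
    intro v hv
    rw [norm_smul, Real.norm_of_nonneg hspos.le, hs, div_mul_eq_mul_div, div_le_iff₀ (by positivity)]
    gcongr
  have h1 := hV _ (V.smul_mem s hp) (hsmall p hpn)
  have h2 := hW _ (W.smul_mem s hq) (hsmall q hqn)
  rw [inner_smul_right] at h1 h2
  have h3 : inner ℝ w p + inner ℝ w q = ‖w‖ * ‖w‖ := by
    rw [← inner_add_right, hpq, real_inner_self_eq_norm_mul_norm]
  have h4 : s * (‖w‖ * ‖w‖) ≤ 2 * ε := by rw [← h3]; linarith
  have h5 : s * (‖w‖ * ‖w‖) = δ / K * ‖w‖ := by rw [hs]; field_simp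
  rw [h5] at h4
  calc ‖w‖ = K / δ * (δ / K * ‖w‖) := by field_simp
    _ ≤ K / δ * (2 * ε) := by gcongr
    _ = 2 * K / δ * ε := by ring

end RelativeInterior

/-! ### Convex sets. -/

section ConvexCase

variable {X : Type*} [NormedAddCommGroup X] [InnerProductSpace ℝ X]

theorem direction_affineSpan_union {A B : Set X} {c : X} (hcA : c ∈ A) (hcB : c ∈ B) :
    (affineSpan ℝ (A ∪ B)).direction =
      (affineSpan ℝ A).direction ⊔ (affineSpan ℝ B).direction := by
  rw [AffineSubspace.span_union]
  exact AffineSubspace.direction_sup_eq_sup_direction (mem_affineSpan ℝ hcA) (mem_affineSpan ℝ hcB)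

/-- If the residuals `u`, `v` of the two projections have `lam • u + μ • v` small, then the pairings
of `u` and `v` with `a - c` and `b - c` are small in total. -/
theorem inner_residuals_le {lam μ : ℝ} (hlam : lam ∈ Set.Ioc (0 : ℝ) 2)
    (hμ : μ ∈ Set.Ioc (0 : ℝ) 2) (x a b c : X) :
    μ * (lam * inner ℝ (x - a) (a - c) + μ * inner ℝ (x - lam • (x - a) - b) (b - c)) ≤
      lam * inner ℝ (x - a) (lam • (x - a) + μ • (x - lam • (x - a) - b)) +
        μ * inner ℝ (lam • (x - a) + μ • (x - lam • (x - a) - b)) (b - c) := by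
  set u := x - a with hu
  set v := x - lam • u - b with hv
  have hac : a - c = (b - c) + ((lam - 1) • u + v) := by
    rw [hv, hu]; module
  -- Right side minus left side is exactly λκ‖u‖², and 2κ = λ(2 - μ) + μ(2 - λ).
  have hκ : 0 ≤ lam * (lam + μ - lam * μ) := by
    obtain ⟨h1, h2⟩ := hlam
    obtain ⟨h3, h4⟩ := hμ
    nlinarith [mul_nonneg h1.le (sub_nonneg.2 h4), mul_nonneg h3.le (sub_nonneg.2 h2)]
  rw [hac]
  simp only [inner_add_left, inner_add_right, inner_smul_left, inner_smul_right,
    real_inner_self_eq_norm_sq, conj_trivial, real_inner_comm]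
  nlinarith [mul_nonneg hκ (sq_nonneg ‖u‖)]

/-- Carries both claims of (i): the first estimate alone gives the first claim, and the second
removes n when κ > 0. -/
theorem exists_inter_add_orthogonal [FiniteDimensional ℝ X] {lam μ : ℝ}
    (hlam : lam ∈ Set.Ioc (0 : ℝ) 2) (hμ : μ ∈ Set.Ioc (0 : ℝ) 2) {A B : Set X}
    (hA : Convex ℝ A) (hB : Convex ℝ B)
    (hri : (intrinsicInterior ℝ A ∩ intrinsicInterior ℝ B).Nonempty)
    {S : Set X} (hS : Bornology.IsBounded S) :
    ∃ K > 0, ∀ x ∈ S, ∀ a ∈ projector A x, ∀ b ∈ projector B (x - lam • (x - a)),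
      ∃ z ∈ A ∩ B, ∃ n ∈ (affineSpan ℝ (A ∪ B)).directionᗮ,
        ‖x - (z + n)‖ ≤ K * ‖lam • (x - a) + μ • (x - lam • (x - a) - b)‖ ∧
        (lam + μ - lam * μ) * ‖n‖ ≤ 2 * ‖lam • (x - a) + μ • (x - lam • (x - a) - b)‖ := by
  obtain ⟨c, hcA, hcB⟩ := hri
  have hcA' := intrinsicInterior_subset hcA
  have hcB' := intrinsicInterior_subset hcB
  rw [direction_affineSpan_union hcA' hcB']
  obtain ⟨δ₁, hδ₁, hballA⟩ := exists_ball_of_mem_intrinsicInterior hcA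
  obtain ⟨δ₂, hδ₂, hballB⟩ := exists_ball_of_mem_intrinsicInterior hcB
  have hspA : ∀ a ∈ A, a - c ∈ (affineSpan ℝ A).direction := fun a ha =>
    AffineSubspace.vsub_mem_direction (mem_affineSpan ℝ ha) (mem_affineSpan ℝ hcA')
  have hspB : ∀ b ∈ B, b - c ∈ (affineSpan ℝ B).direction := fun b hb =>
    AffineSubspace.vsub_mem_direction (mem_affineSpan ℝ hb) (mem_affineSpan ℝ hcB')
  generalize (affineSpan ℝ A).direction = V at *
  generalize (affineSpan ℝ B).direction = W at *
  set δ := min δ₁ δ₂ with hδdef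
  have hδ : 0 < δ := lt_min hδ₁ hδ₂
  replace hballA : ∀ p ∈ V, ‖p‖ ≤ δ → c + p ∈ A :=
    fun p hp h => hballA p hp (h.trans (min_le_left _ _))
  replace hballB : ∀ p ∈ W, ‖p‖ ≤ δ → c + p ∈ B :=
    fun p hp h => hballB p hp (h.trans (min_le_right _ _))
  obtain ⟨R₀, hR₀⟩ := hS.exists_norm_le
  set R := |R₀| + ‖c‖ with hRdef
  have hR : 0 ≤ R := by positivity
  have hSR : ∀ x ∈ S, ‖x - c‖ ≤ R := fun x hx =>
    (norm_sub_le _ _).trans (by rw [hRdef]; gcongr; exact (hR₀ x hx).trans (le_abs_self _))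
  obtain ⟨K₁, hK₁, hreg⟩ :=
    exists_mem_inter_norm_sub_le hA hB hδ hballA hballB (2 * R) (by positivity)
  obtain ⟨K₂, hK₂, hnorm⟩ := exists_norm_le_of_inner_le V W hδ
  have hlam0 := hlam.1
  have hμ0 := hμ.1
  have hκ : 0 ≤ lam + μ - lam * μ := by
    nlinarith [mul_nonneg hlam0.le (sub_nonneg.2 hμ.2), mul_nonneg hμ0.le (sub_nonneg.2 hlam.2)]
  set κ := lam + μ - lam * μ with hκdef
  -- D will bound ‖Qu‖/‖w‖. Here 14R = 2·R + 2·6R, from λ, μ ≤ 2, ‖u‖ ≤ R and ‖b - c‖ ≤ 6R; the δ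
  -- comes from ⟨w, q⟩ ≤ δ‖w‖.
  set D := K₂ * ((δ + 14 * R / μ) / lam) with hD
  have hDnn : 0 ≤ D := by positivity
  refine ⟨K₁ * ((κ * D + 1) / μ) + D, by positivity, fun x hx a ha b hb => ?_⟩
  obtain ⟨haA, hvarA⟩ := (mem_projector_iff hA).1 ha
  obtain ⟨hbB, hvarB⟩ := (mem_projector_iff hB).1 hb
  have hres := inner_residuals_le hlam hμ x a b c
  have hu : ‖x - a‖ ≤ R := (norm_sub_le_of_mem_projector ha hcA').trans (hSR x hx)
  have hac : ‖a - c‖ ≤ 2 * R := by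
    have := norm_sub_le (x - c) (x - a)
    rw [sub_sub_sub_cancel_left] at this
    linarith [hSR x hx]
  have hr : ‖x - lam • (x - a) - c‖ ≤ 3 * R := by
    have h1 : x - lam • (x - a) - c = (x - c) - lam • (x - a) := by abel
    have h2 : ‖lam • (x - a)‖ ≤ 2 * R := by
      rw [norm_smul, Real.norm_of_nonneg hlam0.le]
      exact mul_le_mul hlam.2 hu (norm_nonneg _) zero_le_two
    rw [h1]
    linarith [norm_sub_le (x - c) (lam • (x - a)), hSR x hx]
  have hv : ‖x - lam • (x - a) - b‖ ≤ 3 * R := (norm_sub_le_of_mem_projector hb hcB').trans hr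
  have hbc : ‖b - c‖ ≤ 6 * R := by
    have := norm_sub_le (x - lam • (x - a) - c) (x - lam • (x - a) - b)
    rw [sub_sub_sub_cancel_left] at this
    linarith
  have hμab : μ • (a - b) = -κ • (x - a) +
      (lam • (x - a) + μ • (x - lam • (x - a) - b)) := by
    rw [hκdef]; module
  have hwdef : lam • (x - a) =
    (lam • (x - a) + μ • (x - lam • (x - a) - b)) - μ • (x - lam • (x - a) - b) := by abel
  generalize hu' : x - a = u at *
  generalize hv' : x - lam • u - b = v at *
  generalize lam • u + μ • v = w at *
  have hua : ∀ p ∈ V, ‖p‖ ≤ δ → inner ℝ u p ≤ inner ℝ u (a - c) := by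
    intro p hp hpn
    have := hvarA _ (hballA p hp hpn)
    rw [add_sub_right_comm, ← neg_sub a c, inner_add_right, inner_neg_right] at this
    linarith
  have hvb : ∀ q ∈ W, ‖q‖ ≤ δ → inner ℝ v q ≤ inner ℝ v (b - c) := by
    intro q hq hqn
    have := hvarB _ (hballB q hq hqn)
    rw [add_sub_right_comm, ← neg_sub b c, inner_add_right, inner_neg_right] at this
    linarith
  have hua0 : 0 ≤ inner ℝ u (a - c) := by simpa [hδ.le] using hua 0 V.zero_mem
  have hvb0 : 0 ≤ inner ℝ v (b - c) := by simpa [hδ.le] using hvb 0 W.zero_mem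
  have htot : μ * (lam * inner ℝ u (a - c) + μ * inner ℝ v (b - c)) ≤ 14 * R * ‖w‖ := by
    have h1 : inner ℝ u w ≤ R * ‖w‖ := (real_inner_le_norm _ _).trans (by gcongr)
    have h2 : inner ℝ w (b - c) ≤ ‖w‖ * (6 * R) := (real_inner_le_norm _ _).trans (by gcongr)
    have h3 : lam * inner ℝ u w ≤ 2 * (R * ‖w‖) :=
      (mul_le_mul_of_nonneg_left h1 hlam0.le).trans
        (mul_le_mul_of_nonneg_right hlam.2 (by positivity))
    have h4 : μ * inner ℝ w (b - c) ≤ 2 * (‖w‖ * (6 * R)) :=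
      (mul_le_mul_of_nonneg_left h2 hμ0.le).trans
        (mul_le_mul_of_nonneg_right hμ.2 (by positivity))
    linarith
  have htot' : lam * inner ℝ u (a - c) + μ * inner ℝ v (b - c) ≤ 14 * R / μ * ‖w‖ := by
    rw [div_mul_eq_mul_div, le_div_iff₀ hμ0]
    linarith
  have hμvb0 : 0 ≤ μ * inner ℝ v (b - c) := by positivity
  have hlua0 : 0 ≤ lam * inner ℝ u (a - c) := by positivity
  have hε : (δ + 14 * R / μ) / lam * ‖w‖ = (δ * ‖w‖ + 14 * R / μ * ‖w‖) / lam := by ring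
  have hδw : 0 ≤ δ * ‖w‖ := by positivity
  have hV : ∀ p ∈ V, ‖p‖ ≤ δ → inner ℝ u p ≤ (δ + 14 * R / μ) / lam * ‖w‖ := by
    intro p hp hpn
    rw [hε, le_div_iff₀ hlam0]
    have := mul_le_mul_of_nonneg_left (hua p hp hpn) hlam0.le
    linarith
  -- Control of v on W passes to u through λu = w - μv; the minus sign calls for testing v against
  -- -q.
  have hW : ∀ q ∈ W, ‖q‖ ≤ δ → inner ℝ u q ≤ (δ + 14 * R / μ) / lam * ‖w‖ := by
    intro q hq hqn
    rw [hε, le_div_iff₀ hlam0]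
    have h1 := mul_le_mul_of_nonneg_left (hvb (-q) (W.neg_mem hq) (by rwa [norm_neg])) hμ0.le
    have h2 : inner ℝ u q * lam = inner ℝ w q - μ * inner ℝ v q := by
      have := congrArg (fun y => inner ℝ y q) hwdef
      simp only [inner_sub_left, inner_smul_left, conj_trivial] at this
      linarith
    have h3 : inner ℝ w q ≤ δ * ‖w‖ := by
      rw [mul_comm]
      exact (real_inner_le_norm _ _).trans (by gcongr)
    rw [inner_neg_right] at h1
    linarith
  set Q := (V ⊔ W).starProjection with hQ
  have hQinner : ∀ p ∈ V ⊔ W, inner ℝ (Q u) p = inner ℝ u p := by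
    intro p hp
    rw [hQ, Submodule.inner_starProjection_left_eq_right, Submodule.starProjection_eq_self_iff.2 hp]
  have hQu : ‖Q u‖ ≤ D * ‖w‖ := by
    rw [hD, mul_assoc]
    refine hnorm _ (Submodule.starProjection_apply_mem _ _) _ (by positivity) ?_ ?_
    · intro p hp hpn
      rw [hQinner p (Submodule.mem_sup_left hp)]
      exact hV p hp hpn
    · intro q hq hqn
      rw [hQinner q (Submodule.mem_sup_right hq)]
      exact hW q hq hqn
  have hQw : ‖Q w‖ ≤ ‖w‖ := Submodule.norm_starProjection_apply_le _ _
  have habVW : a - b ∈ V ⊔ W := by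
    rw [← sub_sub_sub_cancel_right a b c]
    exact sub_mem (Submodule.mem_sup_left (hspA a haA)) (Submodule.mem_sup_right (hspB b hbB))
  -- Q fixes a - b, so the uncontrolled orthogonal part of u drops out.
  have hQab : μ • (a - b) = -κ • Q u + Q w := by
    rw [← map_smul, ← map_add, ← hμab, map_smul, Submodule.starProjection_eq_self_iff.2 habVW]
  have hab : ‖a - b‖ ≤ (κ * D + 1) / μ * ‖w‖ := by
    rw [div_mul_eq_mul_div, le_div_iff₀ hμ0]
    calc ‖a - b‖ * μ = ‖-κ • Q u + Q w‖ := by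
          rw [← hQab, norm_smul, Real.norm_of_nonneg hμ0.le, mul_comm]
      _ ≤ κ * (D * ‖w‖) + ‖w‖ := by
          refine (norm_add_le _ _).trans ?_
          rw [norm_smul, norm_neg, Real.norm_of_nonneg hκ]
          gcongr
      _ = (κ * D + 1) * ‖w‖ := by ring
  obtain ⟨z, hz, haz⟩ := hreg a haA b hbB habVW hac
  refine ⟨z, hz, u - Q u, Submodule.sub_starProjection_mem_orthogonal _, ?_, ?_⟩
  · have : x - (z + (u - Q u)) = (a - z) + Q u := by rw [← hu']; abel
    rw [this]
    calc ‖(a - z) + Q u‖ ≤ ‖a - z‖ + ‖Q u‖ := norm_add_le _ _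
      _ ≤ K₁ * ((κ * D + 1) / μ * ‖w‖) + D * ‖w‖ := by
          gcongr
          exact haz.trans (by gcongr)
      _ = _ := by ring
  · have : κ • (u - Q u) = w - Q w := by
      have h1 : κ • u = w - μ • (a - b) := by rw [hμab]; module
      rw [smul_sub, h1, hQab]
      module
    rw [← Real.norm_of_nonneg hκ, ← norm_smul, this]
    linarith [norm_sub_le w (Q w)]

theorem quasiCoerciveOn_gDR_add_orthogonal [FiniteDimensional ℝ X] {lam μ α : ℝ}
    (hlam : lam ∈ Set.Ioc (0 : ℝ) 2) (hμ : μ ∈ Set.Ioc (0 : ℝ) 2) (hα : 0 < α) {A B : Set X}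
    (hA : Convex ℝ A) (hB : Convex ℝ B)
    (hri : (intrinsicInterior ℝ A ∩ intrinsicInterior ℝ B).Nonempty)
    {S : Set X} (hS : Bornology.IsBounded S) :
    QuasiCoerciveOn (gDR A B lam μ α)
      ((A ∩ B) + ((affineSpan ℝ (A ∪ B)).directionᗮ : Set X)) S := by
  obtain ⟨K, hK, h⟩ := exists_inter_add_orthogonal hlam hμ hA hB hri hS
  refine ⟨α / K, by positivity, fun x hx y hy => ?_⟩
  obtain ⟨a, ha, b, hb, hxy⟩ := mem_gDR_iff.1 hy
  obtain ⟨z, hz, n, hn, hzn, -⟩ := h x hx a ha b hb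
  have hd := Metric.infDist_le_dist_of_mem (x := x) (Set.add_mem_add hz hn)
  rw [dist_eq_norm] at hd
  rw [hxy, norm_smul, Real.norm_of_nonneg hα.le, div_mul_eq_mul_div, div_le_iff₀ hK, mul_assoc]
  gcongr
  rw [mul_comm]
  exact hd.trans hzn

theorem quasiCoerciveOn_gDR_inter [FiniteDimensional ℝ X] {lam μ α : ℝ}
    (hlam : lam ∈ Set.Ioc (0 : ℝ) 2) (hμ : μ ∈ Set.Ioc (0 : ℝ) 2) (hα : 0 < α) {A B : Set X}
    (hA : Convex ℝ A) (hB : Convex ℝ B)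
    (hri : (intrinsicInterior ℝ A ∩ intrinsicInterior ℝ B).Nonempty) (hmin : min lam μ < 2)
    {S : Set X} (hS : Bornology.IsBounded S) :
    QuasiCoerciveOn (gDR A B lam μ α) (A ∩ B) S := by
  obtain ⟨K, hK, h⟩ := exists_inter_add_orthogonal hlam hμ hA hB hri hS
  have hκ : 0 < lam + μ - lam * μ := by
    obtain ⟨h1, h2⟩ := hlam
    obtain ⟨h3, h4⟩ := hμ
    rcases min_lt_iff.1 hmin with h5 | h5
    · nlinarith [mul_pos h3 (sub_pos.2 h5), mul_nonneg h1.le (sub_nonneg.2 h4)]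
    · nlinarith [mul_pos h1 (sub_pos.2 h5), mul_nonneg h3.le (sub_nonneg.2 h2)]
  set κ := lam + μ - lam * μ
  refine ⟨α / (K + 2 / κ), by positivity, fun x hx y hy => ?_⟩
  obtain ⟨a, ha, b, hb, hxy⟩ := mem_gDR_iff.1 hy
  obtain ⟨z, hz, n, hn, hzn, hn2⟩ := h x hx a ha b hb
  have hd := Metric.infDist_le_dist_of_mem (x := x) hz
  rw [dist_eq_norm] at hd
  rw [hxy, norm_smul, Real.norm_of_nonneg hα.le, div_mul_eq_mul_div, div_le_iff₀ (by positivity),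
    mul_assoc]
  gcongr
  have h1 : ‖n‖ ≤ 2 / κ * ‖lam • (x - a) + μ • (x - lam • (x - a) - b)‖ := by
    rw [div_mul_eq_mul_div, le_div_iff₀ hκ, mul_comm]
    exact hn2
  have h2 : x - z = (x - (z + n)) + n := by abel
  have h3 := norm_add_le (x - (z + n)) n
  rw [← h2] at h3
  linarith

end ConvexCase

/-! ### Polyhedral sets. -/

section Polyhedral

variable {X : Type*} [NormedAddCommGroup X] [InnerProductSpace ℝ X]

theorem isPolyhedral_setOf {ι : Type*} [Finite ι] (a : ι → X) (b : ι → ℝ) :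
    IsPolyhedral {x | ∀ i, inner ℝ (a i) x ≤ b i} := by
  have := Fintype.ofFinite ι
  refine ⟨Fintype.card ι, a ∘ (Fintype.equivFin ι).symm, b ∘ (Fintype.equivFin ι).symm, ?_⟩
  ext x
  exact (Fintype.equivFin ι).symm.surjective.forall

theorem IsPolyhedral.inter {P Q : Set X} (hP : IsPolyhedral P) (hQ : IsPolyhedral Q) :
    IsPolyhedral (P ∩ Q) := by
  obtain ⟨n, a, b, rfl⟩ := hP
  obtain ⟨m, a', b', rfl⟩ := hQ
  convert isPolyhedral_setOf (Sum.elim a a') (Sum.elim b b') using 1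
  ext x
  simp

theorem IsPolyhedral.preimage {Y : Type*} [NormedAddCommGroup Y] [InnerProductSpace ℝ Y]
    [CompleteSpace X] [CompleteSpace Y] {P : Set X} (hP : IsPolyhedral P) (f : Y →L[ℝ] X) :
    IsPolyhedral (f ⁻¹' P) := by
  obtain ⟨n, a, b, rfl⟩ := hP
  convert isPolyhedral_setOf (fun i => f.adjoint (a i)) b using 1
  ext x
  simp [ContinuousLinearMap.adjoint_inner_left]

theorem IsPolyhedral.isClosed {P : Set X} (hP : IsPolyhedral P) : IsClosed P := by
  obtain ⟨n, a, b, rfl⟩ := hP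
  rw [Set.ofPred_forall]
  exact isClosed_iInter fun i => isClosed_le (by fun_prop) continuous_const

theorem IsPolyhedral.convex {P : Set X} (hP : IsPolyhedral P) : Convex ℝ P := by
  obtain ⟨n, a, b, rfl⟩ := hP
  rw [Set.ofPred_forall]
  exact convex_iInter fun i => convex_halfSpace_le (innerSL ℝ (a i)).isLinear (b i)

/-! ### Finitely generated cones and polars. -/

/-- The whole space is a finitely generated cone. -/
theorem exists_finite_hull_eq_top [FiniteDimensional ℝ X] :
    ∃ G : Set X, G.Finite ∧ PointedCone.hull ℝ G = ⊤ := by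
  let e := Module.finBasis ℝ X
  refine ⟨Set.range e ∪ Set.range (fun i => -e i), (Set.finite_range _).union (Set.finite_range _), ?_⟩
  rw [eq_top_iff]
  intro z _
  rw [← e.sum_repr z]
  refine sum_mem fun i _ => ?_
  rcases le_total 0 (e.repr z i) with h | h
  · exact Submodule.smul_mem _ (⟨_, h⟩ : {c : ℝ // 0 ≤ c})
      (Submodule.subset_span (Or.inl ⟨i, rfl⟩))
  · have := Submodule.smul_mem (PointedCone.hull ℝ (Set.range e ∪ Set.range (fun i => -e i)))
      (⟨_, neg_nonneg.2 h⟩ : {c : ℝ // 0 ≤ c}) (Submodule.subset_span (Or.inr ⟨i, rfl⟩))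
    rw [Nonneg.mk_smul] at this
    simpa using this

/-- Cutting a finitely generated cone by a half-space through the origin gives a finitely generated
cone. -/
theorem exists_finite_hull_inter_halfSpace {G : Set X} (hG : G.Finite) (a : X) :
    ∃ G' : Set X, G'.Finite ∧ ∀ z, z ∈ PointedCone.hull ℝ G' ↔
      z ∈ PointedCone.hull ℝ G ∧ inner ℝ a z ≤ 0 := by
  set P := {g ∈ G | 0 < inner ℝ a g} with hP
  set N := {g ∈ G | inner ℝ a g ≤ 0} with hN
  have hPN : P ∪ N = G := by
    ext g
    simp only [hP, hN, Set.mem_union, Set.mem_ofPred_eq, ← and_or_left, lt_or_ge, and_true]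
  -- The positive combination of a generator from P and one from N that lies on the hyperplane
  -- orthogonal to `a`.
  let cross : X × X → X := fun q => (-inner ℝ a q.2) • q.1 + (inner ℝ a q.1) • q.2
  set G' := N ∪ cross '' (P ×ˢ N) with hG'
  have hG'N : N ⊆ G' := Set.subset_union_left
  have hsmul : ∀ (C : PointedCone ℝ X) (c : ℝ), 0 ≤ c → ∀ z ∈ C, c • z ∈ C :=
    fun C c hc z hz => Submodule.smul_mem C (⟨c, hc⟩ : {c : ℝ // 0 ≤ c}) hz
  have hle : ∀ z ∈ PointedCone.hull ℝ N, inner ℝ a z ≤ 0 := by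
    intro z hz
    induction hz using Submodule.span_induction with
    | mem g hg => exact hg.2
    | zero => simp
    | add x y _ _ hx hy => rw [inner_add_right]; linarith
    | smul c x _ hx =>
      rw [← Nonneg.coe_smul, inner_smul_right]
      exact mul_nonpos_of_nonneg_of_nonpos c.2 hx
  have hlt : ∀ z ∈ PointedCone.hull ℝ P, z = 0 ∨ 0 < inner ℝ a z := by
    intro z hz
    induction hz using Submodule.span_induction with
    | mem g hg => exact Or.inr hg.2
    | zero => simp
    | add x y _ _ hx hy =>
      rcases hx with rfl | hx
      · simpa using hy
      · rcases hy with rfl | hy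
        · simp [hx]
        · right; rw [inner_add_right]; linarith
    | smul c x _ hx =>
      rcases hx with rfl | hx
      · simp
      · rw [← Nonneg.coe_smul]
        rcases c.2.eq_or_lt with h | h
        · simp [← h]
        · right; rw [inner_smul_right]; positivity
  have hcross₁ : ∀ p ∈ P, ∀ q ∈ PointedCone.hull ℝ N,
      (-inner ℝ a q) • p + (inner ℝ a p) • q ∈ PointedCone.hull ℝ G' := by
    intro p hp q hq
    induction hq using Submodule.span_induction with
    | mem g hg => exact Submodule.subset_span (Or.inr ⟨(p, g), ⟨hp, hg⟩, rfl⟩)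
    | zero => simp
    | add x y _ _ hx hy =>
      convert add_mem hx hy using 1
      rw [inner_add_right]; module
    | smul c x _ hx =>
      convert hsmul _ c.1 c.2 _ hx using 1
      rw [← Nonneg.coe_smul, inner_smul_right]; module
  have hcross₂ : ∀ q ∈ PointedCone.hull ℝ N, ∀ p ∈ PointedCone.hull ℝ P,
      (-inner ℝ a q) • p + (inner ℝ a p) • q ∈ PointedCone.hull ℝ G' := by
    intro q hq p hp
    induction hp using Submodule.span_induction with
    | mem g hg => exact hcross₁ g hg q hq
    | zero => simp
    | add x y _ _ hx hy =>
      convert add_mem hx hy using 1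
      rw [inner_add_right]; module
    | smul c x _ hx =>
      convert hsmul _ c.1 c.2 _ hx using 1
      rw [← Nonneg.coe_smul, inner_smul_right]; module
  refine ⟨G', (hG.subset (Set.sep_subset _ _)).union
    (((hG.subset (Set.sep_subset _ _)).prod (hG.subset (Set.sep_subset _ _))).image _), ?_⟩
  intro z
  constructor
  · intro hz
    induction hz using Submodule.span_induction with
    | mem g hg =>
      rcases hg with hg | ⟨⟨p, q⟩, ⟨hp, hq⟩, rfl⟩
      · exact ⟨Submodule.subset_span hg.1, hg.2⟩
      · refine ⟨add_mem (hsmul _ _ (neg_nonneg.2 hq.2) _ (Submodule.subset_span hp.1))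
          (hsmul _ _ hp.2.le _ (Submodule.subset_span hq.1)), ?_⟩
        simp only [cross, inner_add_right, inner_smul_right]
        linarith
    | zero => simp
    | add x y _ _ hx hy =>
      exact ⟨add_mem hx.1 hy.1, by rw [inner_add_right]; linarith [hx.2, hy.2]⟩
    | smul c x _ hx =>
      refine ⟨Submodule.smul_mem _ _ hx.1, ?_⟩
      rw [← Nonneg.coe_smul, inner_smul_right]
      exact mul_nonpos_of_nonneg_of_nonpos c.2 hx.2
  · rintro ⟨hz, haz⟩
    rw [← hPN, PointedCone.hull, Submodule.span_union] at hz
    obtain ⟨p, hp, q, hq, rfl⟩ := Submodule.mem_sup.1 hz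
    have hqG' : q ∈ PointedCone.hull ℝ G' := Submodule.span_mono hG'N hq
    rcases hlt p hp with rfl | hpos
    · simpa using hqG'
    rw [inner_add_right] at haz
    have hq0 : 0 < -inner ℝ a q := by linarith
    -- The last coefficient is nonnegative exactly because ⟨a, p + q⟩ ≤ 0.
    have hsplit : p + q = (-inner ℝ a q)⁻¹ • ((-inner ℝ a q) • p + (inner ℝ a p) • q) +
        (1 - (-inner ℝ a q)⁻¹ * inner ℝ a p) • q := by
      rw [smul_add, smul_smul, inv_mul_cancel₀ hq0.ne']
      module
    rw [hsplit]
    refine add_mem (hsmul _ _ (inv_nonneg.2 hq0.le) _ (hcross₂ q hq p hp))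
      (hsmul _ _ ?_ _ hqG')
    rw [sub_nonneg, inv_mul_le_iff₀ hq0]
    linarith

/-- Minkowski's theorem: polyhedral cones are finitely generated. -/
theorem exists_finite_hull_eq_polyhedralCone [FiniteDimensional ℝ X] {ι : Type*} (a : ι → X)
    (I : Finset ι) :
    ∃ G : Set X, G.Finite ∧ ∀ z, z ∈ PointedCone.hull ℝ G ↔ ∀ i ∈ I, inner ℝ (a i) z ≤ 0 := by
  classical
  induction I using Finset.induction_on with
  | empty =>
    obtain ⟨G, hG, h⟩ := exists_finite_hull_eq_top (X := X)
    exact ⟨G, hG, by simp [h]⟩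
  | insert i I _ ih =>
    obtain ⟨G, hG, h⟩ := ih
    obtain ⟨G', hG', h'⟩ := exists_finite_hull_inter_halfSpace hG (a i)
    exact ⟨G', hG', fun z => by rw [h', h, Finset.forall_mem_insert, and_comm]⟩

/-- The polar of a polyhedral cone is polyhedral. -/
theorem isPolyhedral_polar [FiniteDimensional ℝ X] {ι : Type*} (a : ι → X) (I : Finset ι) :
    IsPolyhedral {u : X | ∀ z, (∀ i ∈ I, inner ℝ (a i) z ≤ 0) → inner ℝ u z ≤ 0} := by
  obtain ⟨G, hG, h⟩ := exists_finite_hull_eq_polyhedralCone a I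
  have := hG.to_subtype
  convert isPolyhedral_setOf (fun g : G => (g : X)) (fun _ => 0) using 1
  ext u
  simp only [← h, Set.mem_ofPred_eq, Subtype.forall]
  constructor
  · intro hu g hg
    rw [real_inner_comm]
    exact hu g (Submodule.subset_span hg)
  · intro hu z hz
    induction hz using Submodule.span_induction with
    | mem g hg => rw [real_inner_comm]; exact hu g hg
    | zero => simp
    | add x y _ _ hx hy => rw [inner_add_right]; linarith
    | smul c x _ hx =>
      rw [← Nonneg.coe_smul, inner_smul_right]
      exact mul_nonpos_of_nonneg_of_nonpos c.2 hx

/-! ### Normal cones. -/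

/-- Directions along which finitely many active constraints do not increase are feasible. -/
theorem exists_pos_add_smul_mem {ι : Type*} [Finite ι] (a : ι → X) (b : ι → ℝ) {p z : X}
    (hp : ∀ i, inner ℝ (a i) p ≤ b i)
    (hz : ∀ i, inner ℝ (a i) p = b i → inner ℝ (a i) z ≤ 0) :
    ∃ t > (0 : ℝ), ∀ i, inner ℝ (a i) (p + t • z) ≤ b i := by
  have hev : ∀ i, ∀ᶠ t : ℝ in nhdsWithin 0 (Set.Ioi 0), inner ℝ (a i) (p + t • z) ≤ b i := by
    intro i
    rcases (hp i).eq_or_lt with h | h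
    · filter_upwards [self_mem_nhdsWithin] with t ht
      rw [inner_add_right, inner_smul_right, h]
      linarith [mul_nonpos_of_nonneg_of_nonpos (le_of_lt ht) (hz i h)]
    · have hc : Filter.Tendsto (fun t : ℝ => inner ℝ (a i) (p + t • z)) (nhds 0)
          (nhds (inner ℝ (a i) (p + (0 : ℝ) • z))) := by
        apply Continuous.tendsto
        fun_prop
      rw [zero_smul, add_zero] at hc
      exact ((hc.eventually_lt_const h).mono fun t ht => ht.le).filter_mono nhdsWithin_le_nhds
  obtain ⟨t, ht, ht0⟩ := ((Filter.eventually_all.2 hev).and self_mem_nhdsWithin).exists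
  exact ⟨t, ht0, ht⟩

/-- Normal vectors at a point of a polyhedral set are polar to the cone of active constraints. -/
theorem inner_le_zero_of_normal {ι : Type*} [Finite ι] (a : ι → X) (b : ι → ℝ) {p u z : X}
    (hp : ∀ i, inner ℝ (a i) p ≤ b i)
    (hu : ∀ y, (∀ i, inner ℝ (a i) y ≤ b i) → inner ℝ u (y - p) ≤ 0)
    (hz : ∀ i, inner ℝ (a i) p = b i → inner ℝ (a i) z ≤ 0) : inner ℝ u z ≤ 0 := by
  obtain ⟨t, ht, h⟩ := exists_pos_add_smul_mem a b hp hz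
  have := hu _ h
  rw [add_sub_cancel_left, inner_smul_right] at this
  exact nonpos_of_mul_nonpos_right this ht

/-- The graph of the normal cone of a polyhedral set is a finite union of products of polyhedral
sets. -/
theorem IsPolyhedral.exists_normal_pieces [FiniteDimensional ℝ X] {A : Set X}
    (hA : IsPolyhedral A) :
    ∃ (n : ℕ) (E F : Finset (Fin n) → Set X), (∀ I, IsPolyhedral (E I)) ∧
      (∀ I, IsPolyhedral (F I)) ∧
      ∀ p u, (p ∈ A ∧ ∀ z ∈ A, inner ℝ u (z - p) ≤ 0) ↔ ∃ I, p ∈ E I ∧ u ∈ F I := by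
  classical
  obtain ⟨n, a, b, rfl⟩ := id hA
  -- On E I the constraints in I are active, possibly with others; F I is the polar of the cone they
  -- define. The full active set of p witnesses the forward direction.
  refine ⟨n, fun I => {x | ∀ i, inner ℝ (a i) x ≤ b i} ∩
      {x | ∀ i : I, inner ℝ (-a i) x ≤ -b i},
    fun I => {u | ∀ z, (∀ i ∈ I, inner ℝ (a i) z ≤ 0) → inner ℝ u z ≤ 0},
    fun I => hA.inter (isPolyhedral_setOf _ _), fun I => isPolyhedral_polar a I, fun p u => ?_⟩
  constructor
  · rintro ⟨hp, hu⟩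
    refine ⟨Finset.univ.filter fun i => inner ℝ (a i) p = b i, ⟨hp, ?_⟩, ?_⟩
    · rintro ⟨i, hi⟩
      rw [Finset.mem_filter] at hi
      simp [inner_neg_left, hi.2]
    · intro z hz
      exact inner_le_zero_of_normal a b hp hu fun i hi => hz i (by simp [hi])
  · rintro ⟨I, ⟨hp, hI⟩, hu⟩
    refine ⟨hp, fun z hz => hu _ fun i hi => ?_⟩
    have := hI ⟨i, hi⟩
    rw [inner_neg_left] at this
    rw [inner_sub_right]
    linarith [hz i]

/-! ### Error bounds. -/

/-- A vector polar to a polyhedral cone is controlled by the amount by which it violates the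
constraints of the cone. -/
theorem exists_norm_le_sum_of_polar [FiniteDimensional ℝ X] {ι : Type*} (a : ι → X)
    (I : Finset ι) :
    ∃ K > 0, ∀ u : X, (∀ z, (∀ i ∈ I, inner ℝ (a i) z ≤ 0) → inner ℝ u z ≤ 0) →
      ‖u‖ ≤ K * ∑ i ∈ I, max (inner ℝ (a i) u) 0 := by
  set N := {u : X | ∀ z, (∀ i ∈ I, inner ℝ (a i) z ≤ 0) → inner ℝ u z ≤ 0} with hN
  have hcomp : IsCompact (Metric.sphere (0 : X) 1 ∩ N) :=
    (isCompact_sphere _ _).inter_right (isPolyhedral_polar a I).isClosed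
  -- With no violation u lies in the cone itself, so polarity tested at u gives ‖u‖² ≤ 0.
  have hpos : ∀ u ∈ Metric.sphere (0 : X) 1 ∩ N, 0 < ∑ i ∈ I, max (inner ℝ (a i) u) 0 := by
    rintro u ⟨hu1, hu⟩
    by_contra hcon
    have h0 : ∑ i ∈ I, max (inner ℝ (a i) u) 0 = 0 :=
      le_antisymm (not_lt.1 hcon) (Finset.sum_nonneg fun i _ => le_max_right _ _)
    rw [Finset.sum_eq_zero_iff_of_nonneg fun i _ => le_max_right _ _] at h0
    have := hu u fun i hi => (le_max_left _ _).trans (h0 i hi).le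
    rw [real_inner_self_eq_norm_sq, mem_sphere_zero_iff_norm.1 hu1] at this
    norm_num at this
  obtain ⟨m, hm, hmin⟩ : ∃ m > 0, ∀ u ∈ Metric.sphere (0 : X) 1 ∩ N,
      m ≤ ∑ i ∈ I, max (inner ℝ (a i) u) 0 :=
    hcomp.exists_forall_le' (by fun_prop) hpos
  refine ⟨m⁻¹, by positivity, fun u hu => ?_⟩
  rcases eq_or_ne u 0 with rfl | hne
  · simp
  have hun : 0 < ‖u‖ := norm_pos_iff.2 hne
  have := hmin (‖u‖⁻¹ • u) ⟨by simp [norm_smul, hun.ne'], fun z hz => by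
    rw [inner_smul_left]
    exact mul_nonpos_of_nonneg_of_nonpos (by simp) (hu z hz)⟩
  have hsum : ∑ i ∈ I, max (inner ℝ (a i) (‖u‖⁻¹ • u)) 0 =
      ‖u‖⁻¹ * ∑ i ∈ I, max (inner ℝ (a i) u) 0 := by
    rw [Finset.mul_sum]
    refine Finset.sum_congr rfl fun i _ => ?_
    rw [inner_smul_right, mul_max_of_nonneg _ _ (by positivity), mul_zero]
  rw [hsum, le_inv_mul_iff₀ hun] at this
  rw [le_inv_mul_iff₀ hm]
  linarith

/-- Hoffman's error bound for a consistent system of linear inequalities. -/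
theorem hoffman_error_bound [FiniteDimensional ℝ X] {ι : Type*} [Fintype ι] (a : ι → X)
    (b : ι → ℝ) (hne : ∃ x, ∀ i, inner ℝ (a i) x ≤ b i) :
    ∃ K > 0, ∀ x, ∃ p, (∀ i, inner ℝ (a i) p ≤ b i) ∧
      ‖x - p‖ ≤ K * ∑ i, max (inner ℝ (a i) x - b i) 0 := by
  classical
  choose K hK hbound using fun I : Finset ι => exists_norm_le_sum_of_polar a I
  have hpoly := isPolyhedral_setOf a b
  -- The active set at the projection varies with x; summing over all I gives a uniform constant.
  refine ⟨∑ I, K I, Finset.sum_pos (fun I _ => hK I) Finset.univ_nonempty, fun x => ?_⟩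
  obtain ⟨p, hp, hxp⟩ := hpoly.isClosed.exists_infDist_eq_dist hne x
  have hproj : p ∈ projector {x | ∀ i, inner ℝ (a i) x ≤ b i} x := ⟨hp, by rw [hxp, dist_eq_norm]⟩
  have hvar := ((mem_projector_iff hpoly.convex).1 hproj).2
  refine ⟨p, hp, ?_⟩
  set I : Finset ι := Finset.univ.filter fun i => inner ℝ (a i) p = b i with hI
  have h1 := hbound I (x - p) fun z hz =>
    inner_le_zero_of_normal a b hp hvar fun i hi => hz i (by simp [hI, hi])
  refine h1.trans (mul_le_mul ?_ ?_ (Finset.sum_nonneg fun i _ => le_max_right _ _)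
    (Finset.sum_nonneg fun I _ => (hK I).le))
  · exact Finset.single_le_sum (fun I _ => (hK I).le) (Finset.mem_univ I)
  · refine (Finset.sum_le_sum fun i hi => ?_).trans
      (Finset.sum_le_sum_of_subset_of_nonneg (Finset.subset_univ I)
        fun i _ _ => le_max_right (inner ℝ (a i) x - b i) 0)
    rw [hI, Finset.mem_filter] at hi
    rw [inner_sub_right, hi.2]

/-- On a bounded part of a polyhedral set, a linear map is either bounded below or its size controls
the distance to its zeros in the set. -/
theorem IsPolyhedral.exists_zero_near_or_le_norm [FiniteDimensional ℝ X] {Z : Type*}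
    [NormedAddCommGroup Z] [InnerProductSpace ℝ Z] [FiniteDimensional ℝ Z] {P : Set X}
    (hP : IsPolyhedral P) (f : X →L[ℝ] Z) (R : ℝ) :
    ∃ ν > 0, ∀ y ∈ P, ‖y‖ ≤ R →
      ν ≤ ‖f y‖ ∨ ∃ p ∈ P, f p = 0 ∧ ν * ‖y - p‖ ≤ ‖f y‖ := by
  by_cases hzero : ∃ p ∈ P, f p = 0
  · obtain ⟨n, a, b, rfl⟩ := hP
    let e := stdOrthonormalBasis ℝ Z
    let κ := Fin (Module.finrank ℝ Z)
    let a' : Fin n ⊕ κ ⊕ κ → X := Sum.elim a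
      (Sum.elim (fun k => f.adjoint (e k)) (fun k => f.adjoint (-e k)))
    let b' : Fin n ⊕ κ ⊕ κ → ℝ := Sum.elim b (fun _ => 0)
    have hiff : ∀ x, (∀ i, inner ℝ (a' i) x ≤ b' i) ↔ (∀ i, inner ℝ (a i) x ≤ b i) ∧ f x = 0 := by
      intro x
      simp only [a', b', Sum.forall, Sum.elim_inl, Sum.elim_inr,
        ContinuousLinearMap.adjoint_inner_left, inner_neg_left]
      refine and_congr_right fun _ => ⟨fun ⟨h1, h2⟩ => ?_, fun h => by simp [h]⟩
      rw [← e.sum_repr' (f x)]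
      refine Finset.sum_eq_zero fun k _ => ?_
      rw [le_antisymm (h1 k) (by linarith [h2 k]), zero_smul]
    obtain ⟨K, hK, hbound⟩ := hoffman_error_bound a' b'
      (by obtain ⟨p, hp, hfp⟩ := hzero; exact ⟨p, (hiff p).2 ⟨hp, hfp⟩⟩)
    -- Each basis vector contributes two inequalities; the +1 keeps M positive when Z is trivial.
    set M : ℝ := K * (2 * (Module.finrank ℝ Z) + 1) with hM
    have hMpos : 0 < M := by positivity
    refine ⟨M⁻¹, by positivity, fun y hy _ => Or.inr ?_⟩
    obtain ⟨p, hp, hyp⟩ := hbound y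
    obtain ⟨hpP, hfp⟩ := (hiff p).1 hp
    refine ⟨p, hpP, hfp, ?_⟩
    rw [inv_mul_le_iff₀ hMpos]
    refine hyp.trans ?_
    rw [hM, mul_assoc]
    gcongr
    have hk : ∀ k : κ, |inner ℝ (e k) (f y)| ≤ ‖f y‖ := fun k => by
      simpa using abs_real_inner_le_norm (e k) (f y)
    rw [Fintype.sum_sum_type, Fintype.sum_sum_type]
    simp only [a', b', Sum.elim_inl, Sum.elim_inr,
        ContinuousLinearMap.adjoint_inner_left, inner_neg_left, sub_zero]
    have h0 : ∑ i, max (inner ℝ (a i) y - b i) 0 = 0 :=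
      Finset.sum_eq_zero fun i _ => max_eq_right (sub_nonpos.2 (hy i))
    have h1 : ∑ k : κ, max (inner ℝ (e k) (f y)) 0 ≤ ∑ k : κ, ‖f y‖ :=
      Finset.sum_le_sum fun k _ => max_le ((le_abs_self _).trans (hk k)) (norm_nonneg _)
    have h2 : ∑ k : κ, max (-inner ℝ (e k) (f y)) 0 ≤ ∑ k : κ, ‖f y‖ :=
      Finset.sum_le_sum fun k _ => max_le ((neg_le_abs _).trans (hk k)) (norm_nonneg _)
    rw [Finset.sum_const, Finset.card_univ, Fintype.card_fin, nsmul_eq_mul] at h1 h2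
    rw [h0]
    linarith [norm_nonneg (f y)]
  · push Not at hzero
    have hcomp : IsCompact (Metric.closedBall (0 : X) R ∩ P) :=
      (isCompact_closedBall _ _).inter_right hP.isClosed
    obtain ⟨m, hm, hmin⟩ : ∃ m > 0, ∀ y ∈ Metric.closedBall (0 : X) R ∩ P, m ≤ ‖f y‖ :=
      hcomp.exists_forall_le' (by fun_prop) fun y hy => norm_pos_iff.2 (hzero y hy.2)
    exact ⟨m, hm, fun y hy hyR => Or.inl (hmin y ⟨by simpa using hyR, hy⟩)⟩

end Polyhedral

/-! ### Quasi coercivity for polyhedral sets. -/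

section PolyhedralCase

variable {X : Type*} [NormedAddCommGroup X] [InnerProductSpace ℝ X]

theorem inter_subset_fixSet_gDR {A B : Set X} (lam μ α : ℝ) :
    A ∩ B ⊆ fixSet (gDR A B lam μ α) := by
  rintro x ⟨hA, hB⟩
  refine mem_gDR_iff.2 ⟨x, self_mem_projector hA, x, ?_, by simp⟩
  simpa using self_mem_projector hB

theorem quasiCoerciveOn_gDR_fixSet [FiniteDimensional ℝ X] {lam μ α : ℝ}
    (hlam : lam ∈ Set.Ioc (0 : ℝ) 2) (hα : 0 < α) {A B : Set X}
    (hA : IsPolyhedral A) (hB : IsPolyhedral B) (hne : (A ∩ B).Nonempty)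
    {S : Set X} (hS : Bornology.IsBounded S) :
    QuasiCoerciveOn (gDR A B lam μ α) (fixSet (gDR A B lam μ α)) S := by
  obtain ⟨x₀, hx₀A, hx₀B⟩ := hne
  obtain ⟨n, EA, FA, hEA, hFA, hgraphA⟩ := hA.exists_normal_pieces
  obtain ⟨m, EB, FB, hEB, hFB, hgraphB⟩ := hB.exists_normal_pieces
  obtain ⟨R₀, hR₀⟩ := hS.exists_norm_le
  set R := |R₀| + ‖x₀‖ with hRdef
  have hR : 0 ≤ R := by positivity
  have hSR : ∀ x ∈ S, ‖x - x₀‖ ≤ R := fun x hx =>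
    (norm_sub_le _ _).trans (by rw [hRdef]; gcongr; exact (hR₀ x hx).trans (le_abs_self _))
  -- Coordinates (a, b, u), with x recovered as a + u; the ℓ² norm supplies the inner product needed
  -- to speak of polyhedra.
  let Y := PiLp 2 (fun _ : Fin 3 => X)
  let pa : Y →L[ℝ] X := PiLp.proj 2 (fun _ => X) 0
  let pb : Y →L[ℝ] X := PiLp.proj 2 (fun _ => X) 1
  let pu : Y →L[ℝ] X := PiLp.proj 2 (fun _ => X) 2
  let pv : Y →L[ℝ] X := pa + (1 - lam) • pu - pb
  let f : Y →L[ℝ] X := lam • pu + μ • pv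
  let P : Finset (Fin n) × Finset (Fin m) → Set Y := fun I =>
    (pa ⁻¹' EA I.1 ∩ pu ⁻¹' FA I.1) ∩ (pb ⁻¹' EB I.2 ∩ pv ⁻¹' FB I.2)
  have hP : ∀ I, IsPolyhedral (P I) := fun I =>
    (((hEA I.1).preimage pa).inter ((hFA I.1).preimage pu)).inter
      (((hEB I.2).preimage pb).inter ((hFB I.2).preimage pv))
  have hpv : ∀ y, pa y + pu y - lam • pu y - pb y = pv y := fun y => by
    simp only [pv, sub_apply, add_apply, smul_apply]
    module
  have hfix : ∀ I, ∀ y ∈ P I, f y = 0 → pa y + pu y ∈ fixSet (gDR A B lam μ α) := by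
    rintro I y ⟨⟨h1, h2⟩, h3, h4⟩ hfy
    have hau : pa y + pu y - pa y = pu y := add_sub_cancel_left _ _
    refine mem_gDR_iff.2 ⟨pa y, ?_, pb y, ?_, ?_⟩
    · rw [mem_projector_iff hA.convex, hau]
      exact (hgraphA _ _).2 ⟨_, h1, h2⟩
    · rw [mem_projector_iff hB.convex, hau, hpv]
      exact (hgraphB _ _).2 ⟨_, h3, h4⟩
    · rw [hau, hpv, sub_self]
      change 0 = α • f y
      rw [hfy, smul_zero]
  set M := ‖x₀‖ + 6 * R with hM
  have hMnn : 0 ≤ M := by positivity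
  choose ν hν hνP using fun I => (hP I).exists_zero_near_or_le_norm f (2 * M)
  obtain ⟨I₀, hI₀⟩ := Finite.exists_min ν
  -- R serves pieces where ‖f‖ is bounded below, as x is within R of a fixed point; 2 serves the
  -- others, as x = a + u moves by at most two coordinate changes.
  refine ⟨α * ν I₀ / (R + 2), div_pos (mul_pos hα (hν I₀)) (by positivity),
    fun x hx x' hx' => ?_⟩
  obtain ⟨a, ha, b, hb, hxx'⟩ := mem_gDR_iff.1 hx'
  have hu : ‖x - a‖ ≤ R := (norm_sub_le_of_mem_projector ha hx₀A).trans (hSR x hx)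
  have ha0 : ‖a - x₀‖ ≤ 2 * R := by
    have := norm_sub_le (x - x₀) (x - a)
    rw [sub_sub_sub_cancel_left] at this
    linarith [hSR x hx]
  have hr : ‖x - lam • (x - a) - x₀‖ ≤ 3 * R := by
    have h1 : x - lam • (x - a) - x₀ = (x - x₀) - lam • (x - a) := by abel
    have h2 : ‖lam • (x - a)‖ ≤ 2 * R := by
      rw [norm_smul, Real.norm_of_nonneg hlam.1.le]
      exact mul_le_mul hlam.2 hu (norm_nonneg _) zero_le_two
    rw [h1]
    linarith [norm_sub_le (x - x₀) (lam • (x - a)), hSR x hx]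
  have hb0 : ‖b - x₀‖ ≤ 6 * R := by
    have h1 := norm_sub_le_of_mem_projector hb hx₀B
    have := norm_sub_le (x - lam • (x - a) - x₀) (x - lam • (x - a) - b)
    rw [sub_sub_sub_cancel_left] at this
    linarith
  have han : ‖a‖ ≤ M := by linarith [norm_le_norm_add_norm_sub x₀ a, norm_sub_rev x₀ a]
  have hbn : ‖b‖ ≤ M := by linarith [norm_le_norm_add_norm_sub x₀ b, norm_sub_rev x₀ b]
  have hun : ‖x - a‖ ≤ M := by linarith [norm_nonneg x₀]
  let y : Y := WithLp.toLp 2 ![a, b, x - a]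
  have hya : pa y = a := rfl
  have hyb : pb y = b := rfl
  have hyu : pu y = x - a := rfl
  have hyv : pv y = x - lam • (x - a) - b := by
    rw [← hpv, hya, hyb, hyu, add_sub_cancel]
  have hyf : f y = lam • (x - a) + μ • (x - lam • (x - a) - b) := by
    rw [← hyv, ← hyu]; rfl
  have hyn : ‖y‖ ≤ 2 * M := by
    refine abs_le_of_sq_le_sq' ?_ (by positivity) |>.2
    rw [PiLp.norm_sq_eq_of_L2, Fin.sum_univ_three]
    change ‖a‖ ^ 2 + ‖b‖ ^ 2 + ‖x - a‖ ^ 2 ≤ _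
    nlinarith [pow_le_pow_left₀ (norm_nonneg _) han 2, pow_le_pow_left₀ (norm_nonneg _) hbn 2,
      pow_le_pow_left₀ (norm_nonneg _) hun 2, sq_nonneg M]
  obtain ⟨I, hIa, hIu⟩ := (hgraphA _ _).1 ((mem_projector_iff hA.convex).1 ha)
  obtain ⟨J, hJb, hJv⟩ := (hgraphB _ _).1 ((mem_projector_iff hB.convex).1 hb)
  have hyP : y ∈ P (I, J) := ⟨⟨hIa, hIu⟩, hJb, by rwa [Set.mem_preimage, hyv]⟩
  rw [hxx', ← hyf, norm_smul, Real.norm_of_nonneg hα.le, div_mul_eq_mul_div,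
    div_le_iff₀ (by positivity), mul_assoc, mul_assoc]
  refine mul_le_mul_of_nonneg_left ?_ hα.le
  have hd0 : Metric.infDist x (fixSet (gDR A B lam μ α)) ≤ R := by
    refine (Metric.infDist_le_dist_of_mem
      (inter_subset_fixSet_gDR lam μ α ⟨hx₀A, hx₀B⟩)).trans ?_
    rw [dist_eq_norm]
    exact hSR x hx
  rcases hνP (I, J) y hyP hyn with hlow | ⟨p, hpP, hfp, hp⟩
  · calc ν I₀ * Metric.infDist x (fixSet (gDR A B lam μ α)) ≤ ‖f y‖ * R :=
          mul_le_mul ((hI₀ _).trans hlow) hd0 Metric.infDist_nonneg (norm_nonneg _)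
      _ ≤ ‖f y‖ * (R + 2) := by gcongr; linarith
  · have hd : Metric.infDist x (fixSet (gDR A B lam μ α)) ≤ 2 * ‖y - p‖ := by
      refine (Metric.infDist_le_dist_of_mem (hfix _ p hpP hfp)).trans ?_
      have h1 : x - (pa p + pu p) = pa (y - p) + pu (y - p) := by
        rw [map_sub, map_sub, hya, hyu]; abel
      have h2 : ‖pa (y - p)‖ ≤ ‖y - p‖ := PiLp.norm_apply_le (y - p) 0
      have h3 : ‖pu (y - p)‖ ≤ ‖y - p‖ := PiLp.norm_apply_le (y - p) 2
      rw [dist_eq_norm, h1]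
      linarith [norm_add_le (pa (y - p)) (pu (y - p))]
    calc ν I₀ * Metric.infDist x (fixSet (gDR A B lam μ α)) ≤ ν (I, J) * (2 * ‖y - p‖) :=
          mul_le_mul (hI₀ _) hd Metric.infDist_nonneg (hν _).le
      _ = ν (I, J) * ‖y - p‖ * 2 := by ring
      _ ≤ ‖f y‖ * (R + 2) := by gcongr; linarith

end PolyhedralCase

theorem proposition4p8 {X : Type*} [NormedAddCommGroup X] [InnerProductSpace ℝ X]
    [FiniteDimensional ℝ X] (lam μ α : ℝ) (hlam : lam ∈ Set.Ioc (0 : ℝ) 2)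
    (hμ : μ ∈ Set.Ioc (0 : ℝ) 2) (hα : 0 < α) :
    (∀ A B : Set X, IsClosed A → Convex ℝ A → IsClosed B → Convex ℝ B →
      (intrinsicInterior ℝ A ∩ intrinsicInterior ℝ B).Nonempty →
        (∀ S : Set X, Bornology.IsBounded S →
          QuasiCoerciveOn (gDR A B lam μ α)
            ((A ∩ B) + ((affineSpan ℝ (A ∪ B)).directionᗮ : Set X)) S) ∧
        (min lam μ < 2 → ∀ S : Set X, Bornology.IsBounded S →
          QuasiCoerciveOn (gDR A B lam μ α) (A ∩ B) S)) ∧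
    (∀ A B : Set X, IsPolyhedral A → IsPolyhedral B → (A ∩ B).Nonempty →
      ∀ S : Set X, Bornology.IsBounded S →
        QuasiCoerciveOn (gDR A B lam μ α) (fixSet (gDR A B lam μ α)) S) := by
  exact ⟨fun A B _ hA _ hB hri =>
    ⟨fun _ hS => quasiCoerciveOn_gDR_add_orthogonal hlam hμ hα hA hB hri hS,
    fun hmin _ hS => quasiCoerciveOn_gDR_inter hlam hμ hα hA hB hri hmin hS⟩,
    fun A B hA hB hne _ hS => quasiCoerciveOn_gDR_fixSet hlam hα hA hB hne hS⟩
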